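/- Let $G$ be a locally compact (Hausdorff) group with a fixed left Haar measure $m$. Let $L^1(G)=L^1(G,m)$ be its complex group algebra, with the convolution product $(\varphi*\psi)(x)=\int_G\varphi(y)\psi(y^{-1}x)\,dm(y)$, and let $M(G)$ be the space of regular complex Borel measures on $G$; for $\mu\in M(G)$ and $\varphi\in L^1(G)$ let $\mu*\varphi\in L^1(G)$ be the convolution $(\mu*\varphi)(x)=\int_G\varphi(y^{-1}x)\,d\mu(y)$. Let $\alpha:L^1(G)\to L^1(G)$ be a continuous algebra homomorphism, that is, a continuous $\mathbb C$-linear map with $\alpha(\varphi*\psi)=\alpha(\varphi)*\alpha(\psi)$ for all $\varphi,\psi$. Let $T:L^1(G)\to L^1(G)$ be a continuous Jordan left $\alpha$-centralizer, that is, a continuous additive map such that $T(\varphi*\varphi)=T(\varphi)*\alpha(\varphi)$ for all $\varphi\in L^1(G)$. Then there exists a measure $\mu\in M(G)$ such that $T(\varphi)=\mu*\alpha(\varphi)$ for all $\varphi\in L^1(G)$. -/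

import Mathlib

open MeasureTheory
open scoped ZeroAtInfty ENNReal

namespace GroupAlgebra

section Translation

variable {G : Type*} [Group G] [TopologicalSpace G] [IsTopologicalGroup G]
  [MeasurableSpace G] [BorelSpace G]

/-- The left translate `z ↦ φ (x⁻¹ * z)` of `φ ∈ L¹(G)` by `x`, as an element of `L¹(G)`. -/
noncomputable def leftTranslate {m : Measure G} [m.IsMulLeftInvariant] (x : G) (φ : Lp ℂ 1 m) :
    Lp ℂ 1 m :=
  DomMulAct.mk x⁻¹ • φ

/-- The convolution `φ ∗ ψ` in `L¹(G)`, the `L¹`-valued Bochner integral `∫ φ(y) · (L_y ψ) dm(y)`,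
that is, `(φ ∗ ψ)(z) = ∫ φ(y) ψ(y⁻¹ z) dm(y)`. -/
noncomputable def conv {m : Measure G} [m.IsMulLeftInvariant] (φ ψ : Lp ℂ 1 m) : Lp ℂ 1 m :=
  ∫ y, φ y • leftTranslate y ψ ∂m

/-- The convolution `μ ∗ φ ∈ L¹(G)` of a complex measure `μ` and `φ ∈ L¹(G)`, the `L¹`-valued
integral `∫ (L_y φ) dμ(y)`, that is, `(μ ∗ φ)(z) = ∫ φ(y⁻¹ z) dμ(y)`. -/
noncomputable def measureConv {m : Measure G} [m.IsMulLeftInvariant] (μ : ComplexMeasure G)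
    (φ : Lp ℂ 1 m) : Lp ℂ 1 m :=
  VectorMeasure.integral μ (fun y => leftTranslate y φ) (ContinuousLinearMap.lsmul ℝ ℂ).flip

/-- The measure algebra `M(G)`: complex Borel measures whose total variation is regular. -/
def measureAlgebra (G : Type*) [TopologicalSpace G] [MeasurableSpace G] :
    Set (ComplexMeasure G) :=
  {μ | μ.variation.Regular}

/-- `T` is a Jordan left `α`-centralizer on `L¹(G)`: it is additive and `T(φ ∗ φ) = T(φ) ∗ α(φ)`. -/
structure IsJordanLeftCentralizer {m : Measure G} [m.IsMulLeftInvariant]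
    (α T : Lp ℂ 1 m → Lp ℂ 1 m) : Prop where
  map_add : ∀ φ ψ, T (φ + ψ) = T φ + T ψ
  map_sq : ∀ φ, T (conv φ φ) = conv (T φ) (α φ)

end Translation

/-! The remaining facts show that the two integrals above converge, and that both convolutions
agree with the product of `M(G)` given by
`⟨μ ∗ ν, f⟩ = ∬ f (x * y) dμ(x) dν(y)` for `f ∈ C₀(G)`, where `φ ∈ L¹(G)` is identified with the
measure `φ dm` (the iterated integrals are stated with `x` as the outer variable). -/

section Facts

variable {G : Type*} [Group G] [TopologicalSpace G] [IsTopologicalGroup G]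
  [MeasurableSpace G] [BorelSpace G]

theorem leftTranslate_ae {m : Measure G} [m.IsMulLeftInvariant] (x : G) (φ : Lp ℂ 1 m) :
    leftTranslate x φ =ᵐ[m] fun z => φ (x⁻¹ * z) :=
  DomMulAct.smul_Lp_ae_eq _ _

theorem norm_leftTranslate {m : Measure G} [m.IsMulLeftInvariant] (x : G) (φ : Lp ℂ 1 m) :
    ‖leftTranslate x φ‖ = ‖φ‖ :=
  DomMulAct.norm_smul_Lp _ _

theorem continuous_leftTranslate [LocallyCompactSpace G] {m : Measure G} [m.IsHaarMeasure]
    [m.Regular] (φ : Lp ℂ 1 m) : Continuous fun x : G => leftTranslate x φ := by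
  unfold leftTranslate
  have : Fact ((1 : ℝ≥0∞) ≠ ∞) := ⟨by simp⟩
  fun_prop

theorem aestronglyMeasurable_smul {X E : Type*} [TopologicalSpace X] [R1Space X]
    [MeasurableSpace X] [BorelSpace X] [NormedAddCommGroup E] [NormedSpace ℂ E]
    (ν : Measure X) [ν.Regular] {g : X → ℂ} (hg : Integrable g ν) {F : X → E}
    (hF : Continuous F) : AEStronglyMeasurable (fun x => g x • F x) ν := by
  have key : ∀ n : ℕ, ∃ u : X → ℂ, eLpNorm (g - u) 1 ν ≤ ENNReal.ofReal (1 / ((n : ℝ) + 1)) ∧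
      AEStronglyMeasurable u ν ∧ AEStronglyMeasurable (fun x => u x • F x) ν := fun n => by
    have hn : ENNReal.ofReal (1 / ((n : ℝ) + 1)) ≠ 0 := by
      simp only [ne_eq, ENNReal.ofReal_eq_zero, not_le]
      positivity
    refine (memLp_one_iff_integrable.2 hg).induction_dense (by simp)
      (P := fun u => AEStronglyMeasurable u ν ∧ AEStronglyMeasurable (fun x => u x • F x) ν)
      ?_ ?_ (fun u hu => hu.1) hn
    · intro c t ht htν ε hε
      obtain ⟨η, ηpos, hη⟩ := exists_eLpNorm_indicator_le (p := 1) (μ := ν) (by simp) c hε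
      have hη' : (0 : ℝ≥0∞) < η := ENNReal.coe_pos.2 ηpos
      obtain ⟨s, st, s_compact, s_closed, μs⟩ :
          ∃ s, s ⊆ t ∧ IsCompact s ∧ IsClosed s ∧ ν (t \ s) < η :=
        ht.exists_isCompact_isClosed_sdiff_lt htν.ne hη'.ne'
      refine ⟨s.indicator fun _ => c, ?_,
        aestronglyMeasurable_const.indicator s_closed.measurableSet, ?_⟩
      · rw [← eLpNorm_neg, neg_sub, ← Set.indicator_sdiff st]
        exact hη _ μs.le
      · have : (fun x => s.indicator (fun _ => c) x • F x) = s.indicator fun x => c • F x := by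
          ext x
          by_cases hx : x ∈ s <;> simp [hx]
        rw [this, aestronglyMeasurable_indicator_iff s_closed.measurableSet]
        exact (hF.const_smul c).continuousOn.aestronglyMeasurable_of_isCompact s_compact
          s_closed.measurableSet
    · rintro u v ⟨hu, hu'⟩ ⟨hv, hv'⟩
      exact ⟨hu.add hv, by simpa only [Pi.add_apply, add_smul] using! hu'.add hv'⟩
  choose u hu1 hu2 hu3 using key
  have hlim : Filter.Tendsto (fun n => eLpNorm (u n - g) 1 ν) Filter.atTop (nhds 0) := by
    refine tendsto_of_tendsto_of_tendsto_of_le_of_le tendsto_const_nhds ?_ (fun _ => zero_le)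
      (fun n => (eLpNorm_sub_comm _ _ _ _).trans_le (hu1 n))
    simpa using ENNReal.tendsto_ofReal (tendsto_one_div_add_atTop_nhds_zero_nat (𝕜 := ℝ))
  obtain ⟨ns, -, hns⟩ := (tendstoInMeasure_of_tendsto_eLpNorm one_ne_zero
    hu2 hg.1 hlim).exists_seq_tendsto_ae
  refine aestronglyMeasurable_of_tendsto_ae Filter.atTop
    (f := fun i x => u (ns i) x • F x) (fun i => hu3 _) ?_
  filter_upwards [hns] with x hx using hx.smul_const _

theorem isFiniteMeasure_variation {X : Type*} [MeasurableSpace X] (μ : ComplexMeasure X) :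
    IsFiniteMeasure μ.variation := by
  refine isFiniteMeasure_of_le ((ComplexMeasure.re μ).totalVariation
    + (ComplexMeasure.im μ).totalVariation)
    (VectorMeasure.variation_le_of_forall_enorm_le fun s _ => ?_)
  rw [Measure.add_apply]
  refine le_trans ?_ (add_le_add ((ComplexMeasure.re μ).enorm_le_totalVariation s)
    ((ComplexMeasure.im μ).enorm_le_totalVariation s))
  calc ‖μ s‖ₑ = ‖((μ s).re : ℂ) + (μ s).im * Complex.I‖ₑ := by rw [Complex.re_add_im]
    _ ≤ ‖((μ s).re : ℂ)‖ₑ + ‖((μ s).im : ℂ) * Complex.I‖ₑ := enorm_add_le _ _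
    _ = ‖(μ s).re‖ₑ + ‖(μ s).im‖ₑ := by
      simp only [← ofReal_norm, norm_mul, Complex.norm_I, mul_one, Complex.norm_real]

theorem integrable_mul {X : Type*} [TopologicalSpace X] [MeasurableSpace X] [BorelSpace X]
    {m : Measure X} (f : C₀(X, ℂ)) (φ : Lp ℂ 1 m) : Integrable (fun z => f z * φ z) m :=
  (L1.integrable_coeFn φ).bdd_mul (c := ‖f.toBCF‖)
    (f.continuous.measurable.aestronglyMeasurable)
    (.of_forall fun z => f.toBCF.norm_coe_le_norm z)

variable [LocallyCompactSpace G] {m : Measure G} [m.IsHaarMeasure] [m.Regular]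

theorem integrable_conv (φ ψ : Lp ℂ 1 m) : Integrable (fun y => φ y • leftTranslate y ψ) m := by
  have hφ := L1.integrable_coeFn φ
  refine (hφ.norm.mul_const ‖ψ‖).mono'
    (aestronglyMeasurable_smul m hφ (continuous_leftTranslate ψ)) (.of_forall fun y => ?_)
  rw [norm_smul, norm_leftTranslate]

theorem integrable_measureConv {μ : ComplexMeasure G} (hμ : μ ∈ measureAlgebra G)
    (φ : Lp ℂ 1 m) : μ.Integrable (fun y => leftTranslate y φ) := by
  have := isFiniteMeasure_variation μ
  have : μ.variation.Regular := hμ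
  refine (integrable_const ‖φ‖).mono' ?_ (.of_forall fun y => (norm_leftTranslate y φ).le)
  simpa using aestronglyMeasurable_smul μ.variation (integrable_const (1 : ℂ))
    (continuous_leftTranslate φ)

/-- The functional `φ ↦ ∫ f φ dm` on `L¹(G)` given by `f ∈ C₀(G)`. -/
noncomputable def pairing (m : Measure G) [m.IsHaarMeasure] [m.Regular] (f : C₀(G, ℂ)) :
    Lp ℂ 1 m →L[ℂ] ℂ :=
  LinearMap.mkContinuous
    { toFun := fun φ => ∫ z, f z * φ z ∂m
      map_add' := fun φ ψ => by
        rw [← integral_add (integrable_mul f φ) (integrable_mul f ψ)]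
        refine integral_congr_ae ?_
        filter_upwards [Lp.coeFn_add φ ψ] with z hz
        rw [hz, Pi.add_apply, mul_add]
      map_smul' := fun c φ => by
        rw [RingHom.id_apply, ← integral_smul]
        refine integral_congr_ae ?_
        filter_upwards [Lp.coeFn_smul c φ] with z hz
        rw [hz, Pi.smul_apply, mul_smul_comm] }
    ‖f.toBCF‖ (fun φ => by
      rw [L1.norm_eq_integral_norm, ← integral_const_mul]
      refine norm_integral_le_of_norm_le ((L1.integrable_coeFn φ).norm.const_mul _)
        (.of_forall fun z => ?_)
      rw [norm_mul]
      exact mul_le_mul_of_nonneg_right (f.toBCF.norm_coe_le_norm z) (norm_nonneg _))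

theorem pairing_apply (f : C₀(G, ℂ)) (φ : Lp ℂ 1 m) : pairing m f φ = ∫ z, f z * φ z ∂m := rfl

theorem pairing_leftTranslate (f : C₀(G, ℂ)) (x : G) (φ : Lp ℂ 1 m) :
    pairing m f (leftTranslate x φ) = ∫ y, f (x * y) * φ y ∂m := by
  rw [pairing_apply, ← integral_mul_left_eq_self (fun z => f z * leftTranslate x φ z) x]
  refine integral_congr_ae ?_
  have h := (measurePreserving_mul_left m x).quasiMeasurePreserving.ae (leftTranslate_ae x φ)
  filter_upwards [h] with y hy
  rw [hy, inv_mul_cancel_left]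

theorem pairing_conv (f : C₀(G, ℂ)) (φ ψ : Lp ℂ 1 m) :
    ∫ z, f z * conv φ ψ z ∂m = ∫ x, (∫ y, f (x * y) * ψ y ∂m) * φ x ∂m := by
  rw [← pairing_apply, conv, ← (pairing m f).integral_comp_comm (integrable_conv φ ψ)]
  simp only [map_smul, pairing_leftTranslate, smul_eq_mul, mul_comm]

theorem pairing_measureConv (f : C₀(G, ℂ)) {μ : ComplexMeasure G} (hμ : μ ∈ measureAlgebra G)
    (φ : Lp ℂ 1 m) :
    ∫ z, f z * measureConv μ φ z ∂m =
      μ.integral (fun x => ∫ y, f (x * y) * φ y ∂m) (ContinuousLinearMap.mul ℝ ℂ) := by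
  have hint := integrable_measureConv hμ φ
  have h1 := VectorMeasure.continuousLinearMap_apply_integral
    (B := (ContinuousLinearMap.lsmul ℝ ℂ).flip) (C := (pairing m f).restrictScalars ℝ) hint
  have h2 := VectorMeasure.integral_continuousLinearMap_comp
    (B := ContinuousLinearMap.mul ℝ ℂ) (C := (pairing m f).restrictScalars ℝ) hint
  simp only [ContinuousLinearMap.coe_restrictScalars', pairing_leftTranslate] at h1 h2
  rw [← pairing_apply, measureConv, h1, h2]
  congr 1
  ext e c
  simp [mul_comm]

end Facts

end GroupAlgebra

/-! Polarising T(a²) = T(a)α(a) gives T(aba) = T(a)α(b)α(a), with no commutativity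
(`jordanCentralizer_map_mul_mul`). Let a = e run through a bounded two-sided approximate identity
and put b = ψ. Then e∗ψ∗e → ψ, while α(ψ)∗α(e) = α(ψ∗e) → α(ψ), so T(e)∗α(ψ) → T(ψ) in norm
(`IsJordanLeftCentralizer.tendsto_conv`). The elements α(e) need not form an approximate identity
themselves.

A continuous additive T is bounded, so the T(e) stay in a ball of L¹(G) and converge weak-* along an
ultrafilter to some μ in M(G) (`exists_complexMeasure_tendsto_integral`). For fixed χ, the passage F
↦ F∗χ respects such limits (`tendsto_integral_conv`), so T(e)∗α(ψ) also tends weak-* to μ∗α(ψ).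
Functions in C_c(G) separate L¹(G), hence the two limits agree.

G is neither σ-compact nor unimodular in general. Integrals are therefore interchanged by moving
bounded operators through Bochner integrals, or by Fubini for compactly supported continuous
integrands. -/

section JordanCentralizer

/-! ### The Jordan identity in rings -/

/-- A Jordan left `α`-centralizer of a `2`-torsion-free ring satisfies `T (aba) = T(a) α(b) α(a)`. -/
theorem jordanCentralizer_map_mul_mul {A : Type*} [NonUnitalRing A] [IsAddTorsionFree A]
    {α T : A → A} (hα : ∀ a b, α (a * b) = α a * α b) (hα' : ∀ a b, α (a + b) = α a + α b)
    (hT : ∀ a b, T (a + b) = T a + T b) (hsq : ∀ a, T (a * a) = T a * α a) (a b : A) :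
    T (a * b * a) = T a * α b * α a := by
  have hlin : ∀ a b, T (a * b) + T (b * a) = T a * α b + T b * α a := fun a b => by
    have h := hsq (a + b)
    simp only [add_mul, mul_add, hT, hα', hsq] at h
    rw [← sub_eq_zero] at h ⊢
    rw [← h]
    abel
  -- The argument of T here is a²b + ba² + 2aba. `h2` evaluates T on the first two terms, so the
  -- difference isolates 2T(aba).
  have h1 := hlin a (a * b + b * a)
  have h2 := hlin (a * a) b
  rw [hT (a * b), hlin a b, hα', hα, hα, mul_add, add_mul, hT, hT] at h1
  rw [hsq, hα] at h2
  simp only [mul_add, add_mul, ← mul_assoc] at h1 h2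
  have h3 : (2 : ℕ) • T (a * b * a) = (2 : ℕ) • (T a * α b * α a) := by
    rw [← sub_eq_zero] at h1 h2 ⊢
    rw [← sub_eq_zero.2 (h1.trans h2.symm), two_nsmul, two_nsmul]
    abel
  exact nsmul_right_injective two_ne_zero h3

end JordanCentralizer

namespace GroupAlgebra

/-! ### C_c as test functions for L¹, and its density -/

section TestFunctions

variable {X : Type*} [TopologicalSpace X] [T2Space X] [LocallyCompactSpace X]
  [MeasurableSpace X] [BorelSpace X] {m : Measure X} [m.Regular]

/-- A Urysohn function equal to 1 on K and 0 off an open U ⊇ K changes the integral by at most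
∫_{U∖K} ‖F‖, which outer regularity and absolute continuity make small. -/
theorem setIntegral_eq_zero_of_isCompact {F : X → ℂ} (hF : Integrable F m)
    (h : ∀ f : X → ℂ, Continuous f → HasCompactSupport f → ∫ z, f z * F z ∂m = 0)
    {K : Set X} (hK : IsCompact K) : ∫ z in K, F z ∂m = 0 := by
  refine norm_le_zero_iff.1 (le_of_forall_pos_le_add fun ε hε => ?_)
  obtain ⟨δ, δ0, hδ⟩ := exists_pos_setLIntegral_lt_of_measure_lt (f := fun z => ‖F z‖ₑ) (μ := m)
    hF.2.ne (ε := ENNReal.ofReal ε) (by simpa using hε)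
  obtain ⟨U, hKU, hU, -, hUδ⟩ := hK.measurableSet.exists_isOpen_sdiff_lt (hK.measure_lt_top (μ := m)).ne
    δ0.ne'
  obtain ⟨f, f1, f0, fc, f01⟩ := exists_continuous_one_zero_of_isCompact hK hU.isClosed_compl
    (Set.disjoint_compl_right_iff_subset.2 hKU)
  have hint : Integrable (fun z => (f z : ℂ) * F z) m :=
    hF.bdd_mul (c := 1) (by fun_prop) (.of_forall fun z => by
      rw [Complex.norm_real, Real.norm_of_nonneg (f01 z).1]; exact (f01 z).2)
  have h0 := h (fun z => (f z : ℂ)) (by fun_prop) (fc.comp_left Complex.ofReal_zero)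
  have : ∫ z in K, F z ∂m = ∫ z, (K.indicator F z - (f z : ℂ) * F z) ∂m := by
    rw [integral_sub (hF.indicator hK.measurableSet) hint, h0, sub_zero,
      integral_indicator hK.measurableSet]
  rw [this, zero_add, ← ENNReal.ofReal_le_ofReal_iff hε.le, ofReal_norm]
  refine (enorm_integral_le_lintegral_enorm _).trans (le_trans ?_ (hδ _ hUδ).le)
  rw [← lintegral_indicator (hU.measurableSet.diff hK.measurableSet)]
  refine lintegral_mono fun z => ?_
  by_cases hz : z ∈ K
  · simp [hz, f1 hz]
  · by_cases hzU : z ∈ U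
    · have : ‖(f z : ℂ)‖ₑ ≤ 1 := by
        rw [← ofReal_norm, Complex.norm_real, Real.norm_of_nonneg (f01 z).1]
        simpa using (f01 z).2
      simpa [hz, hzU] using mul_le_of_le_one_left' this
    · simp [hz, hzU, f0 hzU]

theorem ae_eq_zero_of_forall_integral_mul_eq_zero {F : X → ℂ} (hF : Integrable F m)
    (h : ∀ f : X → ℂ, Continuous f → HasCompactSupport f → ∫ z, f z * F z ∂m = 0) :
    F =ᵐ[m] 0 := by
  refine hF.ae_eq_zero_of_forall_setIntegral_eq_zero fun s hs hsm => ?_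
  refine norm_le_zero_iff.1 (le_of_forall_pos_le_add fun ε hε => ?_)
  obtain ⟨δ, δ0, hδ⟩ := exists_pos_setLIntegral_lt_of_measure_lt (f := fun z => ‖F z‖ₑ) (μ := m)
    hF.2.ne (ε := ENNReal.ofReal ε) (by simpa using hε)
  obtain ⟨K, hKs, hK, hKδ⟩ := hs.exists_isCompact_sdiff_lt hsm.ne δ0.ne'
  have h1 := setIntegral_eq_zero_of_isCompact hF h hK
  have h2 := setIntegral_sdiff hK.measurableSet hF.integrableOn hKs
  rw [h1, sub_zero] at h2
  rw [← h2, zero_add, ← ENNReal.ofReal_le_ofReal_iff hε.le, ofReal_norm]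
  exact (enorm_integral_le_lintegral_enorm _).trans (hδ _ hKδ).le

theorem integrable_mul_of_hasCompactSupport {f : X → ℂ} (hf : Continuous f)
    (hfc : HasCompactSupport f) (φ : Lp ℂ 1 m) : Integrable (fun z => f z * φ z) m :=
  integrable_mul (⟨⟨f, hf⟩, hfc.is_zero_at_infty⟩ : C₀(X, ℂ)) φ

theorem Lp_eq_of_forall_integral_mul_eq {φ ψ : Lp ℂ 1 m}
    (h : ∀ f : X → ℂ, Continuous f → HasCompactSupport f →
      ∫ z, f z * φ z ∂m = ∫ z, f z * ψ z ∂m) : φ = ψ := by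
  rw [← sub_eq_zero, Lp.eq_zero_iff_ae_eq_zero]
  refine ae_eq_zero_of_forall_integral_mul_eq_zero (L1.integrable_coeFn _) fun f hf hfc => ?_
  rw [← sub_eq_zero.2 (h f hf hfc), ← integral_sub (integrable_mul_of_hasCompactSupport hf hfc φ)
    (integrable_mul_of_hasCompactSupport hf hfc ψ)]
  refine integral_congr_ae ?_
  filter_upwards [Lp.coeFn_sub φ ψ] with z hz
  rw [hz, Pi.sub_apply, mul_sub]

/-- Indicators suffice: squeeze the set from inside by a compact K, enclose K in an open U, and
interpolate by Urysohn. Both g and its class ψ are returned because later arguments need pointwise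
values. -/
theorem exists_hasCompactSupport_norm_sub_le (φ : Lp ℂ 1 m) {ε : ℝ} (hε : 0 < ε) :
    ∃ (g : X → ℂ) (ψ : Lp ℂ 1 m), Continuous g ∧ HasCompactSupport g ∧ ψ =ᵐ[m] g ∧
      ‖φ - ψ‖ ≤ ε := by
  have hind : ∀ (c : ℂ) ⦃t : Set X⦄, MeasurableSet t → m t < ∞ → ∀ {ε : ℝ≥0∞}, ε ≠ 0 →
      ∃ g : X → ℂ, eLpNorm (g - t.indicator fun _ => c) 1 m ≤ ε ∧
        Continuous g ∧ HasCompactSupport g := by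
    intro c t ht htm ε hε
    obtain ⟨δ, δpos, hδ⟩ := exists_Lp_half ℂ m 1 hε
    obtain ⟨η, ηpos, hη⟩ := exists_eLpNorm_indicator_le (p := 1) (μ := m) (by simp) c δpos.ne'
    have hη' : (η : ℝ≥0∞) ≠ 0 := (ENNReal.coe_pos.2 ηpos).ne'
    obtain ⟨K, hKt, hK, hKη⟩ := ht.exists_isCompact_sdiff_lt htm.ne hη'
    obtain ⟨U, hKU, hU, -, hUη⟩ :=
      hK.measurableSet.exists_isOpen_sdiff_lt (hK.measure_lt_top (μ := m)).ne hη'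
    obtain ⟨f, f1, f0, fc, f01⟩ := exists_continuous_one_zero_of_isCompact hK hU.isClosed_compl
      (Set.disjoint_compl_right_iff_subset.2 hKU)
    have hcont : Continuous fun z => (f z : ℂ) * c := by fun_prop
    refine ⟨fun z => (f z : ℂ) * c, ?_, hcont, fc.comp_left (g := fun r : ℝ => (r : ℂ) * c) (by simp)⟩
    have h1 : eLpNorm ((fun z => (f z : ℂ) * c) - K.indicator fun _ => c) 1 m ≤ δ := by
      refine (eLpNorm_mono fun z => ?_).trans (hη _ hUη.le)
      by_cases hz : z ∈ K
      · simp [hz, f1 hz]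
      · by_cases hzU : z ∈ U
        · have : |f z| ≤ 1 := by rw [abs_of_nonneg (f01 z).1]; exact (f01 z).2
          simpa [hz, hzU] using mul_le_of_le_one_left (norm_nonneg c) this
        · simp [hz, hzU, f0 hzU]
    have h2 : eLpNorm ((K.indicator fun _ => c) - t.indicator fun _ => c) 1 m ≤ δ := by
      rw [← eLpNorm_neg, neg_sub, ← Set.indicator_sdiff hKt]
      exact hη _ hKη.le
    have h3 := hδ _ _ (hcont.aestronglyMeasurable.sub
      (aestronglyMeasurable_const.indicator hK.measurableSet))
      ((aestronglyMeasurable_const.indicator hK.measurableSet).sub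
        (aestronglyMeasurable_const.indicator ht)) h1 h2
    rw [sub_add_sub_cancel] at h3
    exact h3.le
  obtain ⟨g, hg, hgcont, hgc⟩ := (Lp.memLp φ).induction_dense ENNReal.one_ne_top
    (P := fun g : X → ℂ => Continuous g ∧ HasCompactSupport g) hind
    (fun f g hf hg => ⟨hf.1.add hg.1, hf.2.add hg.2⟩)
    (fun g hg => hg.1.aestronglyMeasurable) (ε := ENNReal.ofReal ε) (by simpa using hε)
  have hgm : MemLp g 1 m := memLp_one_iff_integrable.2 (hgcont.integrable_of_hasCompactSupport hgc)
  refine ⟨g, hgm.toLp g, hgcont, hgc, hgm.coeFn_toLp, ?_⟩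
  rw [Lp.norm_def]
  refine ENNReal.toReal_le_of_le_ofReal hε.le (le_trans (le_of_eq (eLpNorm_congr_ae ?_)) hg)
  filter_upwards [Lp.coeFn_sub φ (hgm.toLp g), hgm.coeFn_toLp] with z h1 h2
  rw [h1, Pi.sub_apply, Pi.sub_apply, h2]

end TestFunctions

/-! ### L¹(G) as a convolution algebra -/

section Algebra

variable {G : Type*} [Group G] [TopologicalSpace G] [IsTopologicalGroup G]
  [MeasurableSpace G] [BorelSpace G]

theorem leftTranslate_add {m : Measure G} [m.IsMulLeftInvariant] (x : G) (φ ψ : Lp ℂ 1 m) :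
    leftTranslate x (φ + ψ) = leftTranslate x φ + leftTranslate x ψ :=
  smul_add _ _ _

theorem leftTranslate_smul {m : Measure G} [m.IsMulLeftInvariant] (x : G) (c : ℂ) (φ : Lp ℂ 1 m) :
    leftTranslate x (c • φ) = c • leftTranslate x φ :=
  (smul_comm c _ φ).symm

theorem leftTranslate_mul {m : Measure G} [m.IsMulLeftInvariant] (x y : G) (φ : Lp ℂ 1 m) :
    leftTranslate (x * y) φ = leftTranslate x (leftTranslate y φ) := by
  rw [leftTranslate, leftTranslate, leftTranslate, smul_smul, mul_inv_rev]
  rfl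

/-- Left translation as a continuous linear map on `L¹(G)`. -/
noncomputable def leftTranslateL (m : Measure G) [m.IsMulLeftInvariant] (x : G) :
    Lp ℂ 1 m →L[ℂ] Lp ℂ 1 m :=
  LinearMap.mkContinuous
    { toFun := leftTranslate x
      map_add' := leftTranslate_add x
      map_smul' := leftTranslate_smul x } 1 fun φ => by
    rw [one_mul]; exact (norm_leftTranslate x φ).le

variable [LocallyCompactSpace G] {m : Measure G} [m.IsHaarMeasure] [m.Regular]

theorem conv_add (φ ψ χ : Lp ℂ 1 m) : conv φ (ψ + χ) = conv φ ψ + conv φ χ := by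
  simp only [conv, leftTranslate_add, smul_add]
  exact integral_add (integrable_conv φ ψ) (integrable_conv φ χ)

theorem add_conv (φ ψ χ : Lp ℂ 1 m) : conv (φ + ψ) χ = conv φ χ + conv ψ χ := by
  simp only [conv]
  rw [← integral_add (integrable_conv φ χ) (integrable_conv ψ χ)]
  refine integral_congr_ae ?_
  filter_upwards [Lp.coeFn_add φ ψ] with z hz
  rw [hz, Pi.add_apply, add_smul]

theorem conv_smul (c : ℂ) (φ ψ : Lp ℂ 1 m) : conv φ (c • ψ) = c • conv φ ψ := by
  simp only [conv, leftTranslate_smul]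
  rw [← integral_smul]
  exact integral_congr_ae (.of_forall fun z => smul_comm _ _ _)

theorem smul_conv (c : ℂ) (φ ψ : Lp ℂ 1 m) : conv (c • φ) ψ = c • conv φ ψ := by
  simp only [conv]
  rw [← integral_smul]
  refine integral_congr_ae ?_
  filter_upwards [Lp.coeFn_smul c φ] with z hz
  rw [hz, Pi.smul_apply, smul_assoc]

theorem norm_conv_le (φ ψ : Lp ℂ 1 m) : ‖conv φ ψ‖ ≤ ‖φ‖ * ‖ψ‖ := by
  rw [conv, L1.norm_eq_integral_norm φ, ← integral_mul_const]
  refine norm_integral_le_of_norm_le ((L1.integrable_coeFn φ).norm.mul_const _)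
    (.of_forall fun z => ?_)
  rw [norm_smul, norm_leftTranslate]

/-- Convolution on `L¹(G)` as a continuous bilinear map. -/
noncomputable def convL (m : Measure G) [m.IsHaarMeasure] [m.Regular] :
    Lp ℂ 1 m →L[ℂ] Lp ℂ 1 m →L[ℂ] Lp ℂ 1 m :=
  LinearMap.mkContinuous₂ (LinearMap.mk₂ ℂ conv add_conv smul_conv conv_add conv_smul) 1
    fun φ ψ => by rw [one_mul]; exact norm_conv_le φ ψ

theorem convL_apply (φ ψ : Lp ℂ 1 m) : convL m φ ψ = conv φ ψ := rfl

/-- Left translation moves through the Bochner integral; the substitution y ↦ xy does the rest. -/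
theorem conv_leftTranslate (x : G) (φ ψ : Lp ℂ 1 m) :
    conv (leftTranslate x φ) ψ = leftTranslate x (conv φ ψ) := by
  have h := (leftTranslateL m x).integral_comp_comm (integrable_conv φ ψ)
  change _ = leftTranslate x (conv φ ψ) at h
  rw [← h, conv, ← integral_mul_left_eq_self (fun z => leftTranslate x φ z • leftTranslate z ψ) x]
  refine integral_congr_ae ?_
  filter_upwards [(measurePreserving_mul_left m x).quasiMeasurePreserving.ae
    (leftTranslate_ae x φ)] with y hy
  rw [hy, inv_mul_cancel_left, leftTranslate_mul, map_smul]
  rfl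

/-- The bounded operator `conv · χ` passes inside the integral defining `conv φ ψ`, so no Fubini
theorem is needed. -/
theorem conv_assoc (φ ψ χ : Lp ℂ 1 m) : conv (conv φ ψ) χ = conv φ (conv ψ χ) := by
  have h := ((convL m).flip χ).integral_comp_comm (integrable_conv φ ψ)
  change _ = conv (conv φ ψ) χ at h
  rw [← h, conv]
  refine integral_congr_ae (.of_forall fun y => ?_)
  dsimp only
  rw [map_smul, ContinuousLinearMap.flip_apply, convL_apply, conv_leftTranslate]

/-- `L¹(G)` as a ring under convolution. -/
noncomputable abbrev convRing (m : Measure G) [m.IsHaarMeasure] [m.Regular] :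
    NonUnitalRing (Lp ℂ 1 m) :=
  { (inferInstance : AddCommGroup (Lp ℂ 1 m)) with
    mul := conv
    left_distrib := conv_add
    right_distrib := add_conv
    zero_mul := fun φ => (by simpa using smul_conv 0 0 φ : conv 0 φ = 0)
    mul_zero := fun φ => (by simpa using conv_smul 0 φ 0 : conv φ 0 = 0)
    mul_assoc := conv_assoc }

end Algebra

end GroupAlgebra

namespace GroupAlgebra

/-! ### A two-sided approximate identity -/

section ApproximateIdentity

open Filter Topology Pointwise

variable {G : Type*} [Group G] [TopologicalSpace G] [MeasurableSpace G]

/-- A symmetric probability density with respect to `m` that is continuous with compact support and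
vanishes off `U`. -/
structure IsMollifier (m : Measure G) (U : Set G) (k : G → ℝ) : Prop where
  continuous : Continuous k
  hasCompactSupport : HasCompactSupport k
  nonneg : ∀ y, 0 ≤ k y
  eq_zero : ∀ y ∉ U, k y = 0
  symm : ∀ y, k y⁻¹ = k y
  integral_eq_one : ∫ y, k y ∂m = 1

theorem IsMollifier.mono {m : Measure G} {U V : Set G} {k : G → ℝ} (hk : IsMollifier m U k)
    (h : U ⊆ V) : IsMollifier m V k :=
  { hk with eq_zero := fun y hy => hk.eq_zero y fun hyU => hy (h hyU) }

variable [IsTopologicalGroup G] [BorelSpace G] [LocallyCompactSpace G] [T2Space G]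
  {m : Measure G} [m.IsHaarMeasure] [m.Regular]

/-- Normalise f(y)f(y⁻¹) for a bump f at 1. The symmetry lets right convolution be computed without
the modular function. -/
theorem exists_isMollifier (m : Measure G) [m.IsHaarMeasure] [m.Regular] {U : Set G}
    (hU : U ∈ 𝓝 (1 : G)) : ∃ k, IsMollifier m U k := by
  obtain ⟨f, f1, f0, fc, f01⟩ := exists_continuous_one_zero_of_isCompact (isCompact_singleton)
    isOpen_interior.isClosed_compl
    (Set.disjoint_compl_right_iff_subset.2 (Set.singleton_subset_iff.2 (mem_interior_iff_mem_nhds.2 hU)))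
  have hf1 : f 1 = 1 := f1 rfl
  have hcont : Continuous fun y => f y * f y⁻¹ := by fun_prop
  have hcomp : HasCompactSupport fun y => f y * f y⁻¹ := fc.mul_right
  have hnn : ∀ y, 0 ≤ f y * f y⁻¹ := fun y => mul_nonneg (f01 _).1 (f01 _).1
  have hpos : 0 < ∫ y, f y * f y⁻¹ ∂m :=
    hcont.integral_pos_of_hasCompactSupport_nonneg_nonzero hcomp hnn (x := 1) (by simp [hf1])
  refine ⟨fun y => (∫ y, f y * f y⁻¹ ∂m)⁻¹ * (f y * f y⁻¹), hcont.const_mul _, hcomp.mul_left,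
    fun y => mul_nonneg (inv_nonneg.2 hpos.le) (hnn y), fun y hy => ?_, fun y => ?_, ?_⟩
  · rw [f0 fun h => hy (interior_subset h)]
    simp
  · rw [inv_inv, mul_comm (f y⁻¹)]
  · rw [integral_const_mul, inv_mul_cancel₀ hpos.ne']

/-- The elements of `L¹(G)` given by a mollifier that vanishes off `U`. -/
def mollifiers (m : Measure G) (U : Set G) : Set (Lp ℂ 1 m) :=
  {e | ∃ k, IsMollifier m U k ∧ e =ᵐ[m] fun y => (k y : ℂ)}

theorem mollifiers_mono (m : Measure G) : Monotone (mollifiers m) :=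
  fun _ _ h _ ⟨k, hk, he⟩ => ⟨k, hk.mono h, he⟩

theorem mollifiers_nonempty (m : Measure G) [m.IsHaarMeasure] [m.Regular] {U : Set G}
    (hU : U ∈ 𝓝 (1 : G)) : (mollifiers m U).Nonempty := by
  obtain ⟨k, hk⟩ := exists_isMollifier m hU
  have hkm : MemLp (fun y => (k y : ℂ)) 1 m := memLp_one_iff_integrable.2
    ((Continuous.integrable_of_hasCompactSupport hk.continuous hk.hasCompactSupport).ofReal)
  exact ⟨hkm.toLp _, k, hk, hkm.coeFn_toLp⟩

theorem norm_le_one_of_mem_mollifiers {U : Set G} {e : Lp ℂ 1 m} (he : e ∈ mollifiers m U) :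
    ‖e‖ ≤ 1 := by
  obtain ⟨k, hk, hek⟩ := he
  rw [L1.norm_eq_integral_norm, ← hk.integral_eq_one]
  refine (integral_congr_ae ?_).le
  filter_upwards [hek] with y hy
  rw [hy, Complex.norm_real, Real.norm_of_nonneg (hk.nonneg y)]

/-- The difference is the average of L_yψ − ψ against a probability density living on U. -/
theorem norm_conv_sub_le_of_mem_mollifiers {U : Set G} {e ψ : Lp ℂ 1 m} (he : e ∈ mollifiers m U)
    {ε : ℝ} (hε : ∀ y ∈ U, ‖leftTranslate y ψ - ψ‖ ≤ ε) : ‖conv e ψ - ψ‖ ≤ ε := by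
  obtain ⟨k, hk, hek⟩ := he
  have hki : Integrable k m := hk.continuous.integrable_of_hasCompactSupport hk.hasCompactSupport
  have h1 : ∫ y, e y ∂m = 1 := by
    rw [integral_congr_ae hek, integral_complex_ofReal, hk.integral_eq_one, Complex.ofReal_one]
  have h2 : conv e ψ - ψ = ∫ y, e y • (leftTranslate y ψ - ψ) ∂m := by
    simp only [smul_sub]
    rw [integral_sub (integrable_conv e ψ) ((L1.integrable_coeFn e).smul_const ψ),
      integral_smul_const, h1, one_smul, conv]
  have h3 : ε = ∫ y, k y * ε ∂m := by rw [integral_mul_const, hk.integral_eq_one, one_mul]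
  rw [h2, h3]
  refine norm_integral_le_of_norm_le (hki.mul_const ε) ?_
  filter_upwards [hek] with y hy
  rw [hy, norm_smul, Complex.norm_real, Real.norm_of_nonneg (hk.nonneg y)]
  by_cases hyU : y ∈ U
  · exact mul_le_mul_of_nonneg_left (hε y hyU) (hk.nonneg y)
  · simp [hk.eq_zero y hyU]

/-- Convolving a compactly supported continuous function on the right with a mollifier. -/
theorem conv_ae_eq_of_mem_mollifiers {U : Set G} {e ψ : Lp ℂ 1 m} {k : G → ℝ} {g : G → ℂ}
    (hk : IsMollifier m U k) (he : e =ᵐ[m] fun y => (k y : ℂ)) (hg : Continuous g)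
    (hgc : HasCompactSupport g) (hψ : ψ =ᵐ[m] g) :
    conv ψ e =ᵐ[m] fun z => ∫ y, g (z * y) * k y ∂m := by
  have hkc := hk.continuous
  have hcont : Continuous fun z => ∫ y, g (z * y) * k y ∂m := by
    rw [← continuousOn_univ]
    refine continuousOn_integral_of_compact_support hk.hasCompactSupport
      (by dsimp only [Function.uncurry_def]; fun_prop) fun z y _ hy => ?_
    rw [image_eq_zero_of_notMem_tsupport hy, Complex.ofReal_zero, mul_zero]
  have hcomp : HasCompactSupport fun z => ∫ y, g (z * y) * k y ∂m := by
    refine HasCompactSupport.intro (K := tsupport g * (tsupport k)⁻¹)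
      (IsCompact.mul hgc (IsCompact.inv hk.hasCompactSupport)) fun z hz => ?_
    refine integral_eq_zero_of_ae (.of_forall fun y => ?_)
    by_cases hy : y ∈ tsupport k
    · have : z * y ∉ tsupport g := fun h =>
        hz ⟨z * y, h, y⁻¹, Set.inv_mem_inv.2 hy, mul_inv_cancel_right z y⟩
      simp [image_eq_zero_of_notMem_tsupport this]
    · simp [image_eq_zero_of_notMem_tsupport hy]
  have hmem : MemLp (fun z => ∫ y, g (z * y) * k y ∂m) 1 m :=
    memLp_one_iff_integrable.2 (hcont.integrable_of_hasCompactSupport hcomp)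
  suffices conv ψ e = hmem.toLp _ from this ▸ hmem.coeFn_toLp
  refine Lp_eq_of_forall_integral_mul_eq fun f hf hfc => ?_
  have h1 := pairing_conv (⟨⟨f, hf⟩, hfc.is_zero_at_infty⟩ : C₀(G, ℂ)) ψ e
  change ∫ z, f z * conv ψ e z ∂m = ∫ x, (∫ y, f (x * y) * e y ∂m) * ψ x ∂m at h1
  have h2 : ∫ z, f z * hmem.toLp _ z ∂m = ∫ z, f z * ∫ y, g (z * y) * k y ∂m ∂m := by
    refine integral_congr_ae ?_
    filter_upwards [hmem.coeFn_toLp] with z hz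
    rw [hz]
  have h3 : ∫ x, (∫ y, f (x * y) * e y ∂m) * ψ x ∂m
      = ∫ x, ∫ y, f y * k (x⁻¹ * y) * g x ∂m ∂m := by
    refine integral_congr_ae ?_
    filter_upwards [hψ] with x hx
    rw [hx, ← integral_mul_const, ← integral_mul_left_eq_self (fun y => f y * k (x⁻¹ * y) * g x) x]
    refine integral_congr_ae ?_
    filter_upwards [he] with y hy
    rw [hy, inv_mul_cancel_left]
  have h4 : ∫ x, ∫ y, f y * k (x⁻¹ * y) * g x ∂m ∂m
      = ∫ y, ∫ x, f y * k (x⁻¹ * y) * g x ∂m ∂m := by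
    refine integral_integral_swap_of_hasCompactSupport
      (by dsimp only [Function.uncurry_def]; fun_prop) ?_
    refine HasCompactSupport.intro (IsCompact.prod hgc hfc) fun p hp => ?_
    simp only [Set.mem_prod, not_and_or] at hp
    rcases hp with hp | hp <;> simp [Function.uncurry_def, image_eq_zero_of_notMem_tsupport hp]
  rw [h1, h2, h3, h4]
  congr 1
  ext z
  -- After x ↦ zx the kernel becomes k(y⁻¹), which symmetry turns into k(y).
  rw [← integral_const_mul, ← integral_mul_left_eq_self (fun x => f z * k (x⁻¹ * z) * g x) z]
  congr 1
  ext y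
  rw [mul_inv_rev, inv_mul_cancel_right, hk.symm]
  ring

/-- Right translation need not be isometric for a left Haar measure, so the estimate is pointwise:
the difference is uniformly small and vanishes off a fixed compact K. -/
theorem exists_nhds_norm_conv_sub_le_of_hasCompactSupport {ψ : Lp ℂ 1 m} {g : G → ℂ}
    (hg : Continuous g) (hgc : HasCompactSupport g) (hψ : ψ =ᵐ[m] g) {ε : ℝ} (hε : 0 < ε) :
    ∃ U ∈ 𝓝 (1 : G), ∀ e ∈ mollifiers m U, ‖conv ψ e - ψ‖ ≤ ε := by
  obtain ⟨W, hW, hW1⟩ := exists_compact_mem_nhds (1 : G)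
  -- For y in W, both g(z) and g(zy) vanish when z is outside K.
  set K : Set G := tsupport g * W⁻¹ ∪ tsupport g with hK
  have hKc : IsCompact K := (IsCompact.mul hgc hW.inv).union hgc
  set δ : ℝ := ε / (m.real K + 1) with hδ
  have hpos : 0 < m.real K + 1 := by positivity
  have hδ0 : 0 < δ := div_pos hε hpos
  have hev : ∀ᶠ y in 𝓝 (1 : G), ∀ z ∈ K, ‖g (z * y) - g z‖ < δ := by
    refine hKc.eventually_forall_of_forall_eventually fun z _ => ?_
    have : Continuous fun p : G × G => ‖g (p.2 * p.1) - g p.2‖ := by fun_prop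
    exact this.continuousAt.eventually_lt continuousAt_const (by simpa using hδ0)
  refine ⟨{y | ∀ z ∈ K, ‖g (z * y) - g z‖ < δ} ∩ W, inter_mem hev hW1, fun e he => ?_⟩
  obtain ⟨k, hk, hek⟩ := he
  have hkc := hk.continuous
  have hki : Integrable k m := hk.continuous.integrable_of_hasCompactSupport hk.hasCompactSupport
  have hbound : ∀ z, ‖(∫ y, g (z * y) * k y ∂m) - g z‖ ≤ K.indicator (fun _ => δ) z := fun z => by
    have h1 : g z = ∫ y, g z * k y ∂m := by
      rw [integral_const_mul, integral_complex_ofReal, hk.integral_eq_one, Complex.ofReal_one, mul_one]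
    have hi : Integrable (fun y => g (z * y) * (k y : ℂ)) m :=
      Continuous.integrable_of_hasCompactSupport (by fun_prop)
        (HasCompactSupport.mul_left (hk.hasCompactSupport.comp_left Complex.ofReal_zero))
    have h3 : K.indicator (fun _ => δ) z = ∫ y, k y * K.indicator (fun _ => δ) z ∂m := by
      rw [integral_mul_const, hk.integral_eq_one, one_mul]
    have hi' : Integrable (fun y => g z * (k y : ℂ)) m := hki.ofReal.const_mul _
    rw [h1, ← integral_sub hi hi', h3]
    refine norm_integral_le_of_norm_le (hki.mul_const _) (.of_forall fun y => ?_)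
    rw [← sub_mul, norm_mul, Complex.norm_real, Real.norm_of_nonneg (hk.nonneg y), mul_comm]
    by_cases hy : y ∈ {y | ∀ z ∈ K, ‖g (z * y) - g z‖ < δ} ∩ W
    · refine mul_le_mul_of_nonneg_left ?_ (hk.nonneg y)
      by_cases hz : z ∈ K
      · simpa [hz] using (hy.1 z hz).le
      · have hz1 : z ∉ tsupport g := fun h => hz (Or.inr h)
        have hz2 : z * y ∉ tsupport g := fun h =>
          hz (Or.inl ⟨z * y, h, y⁻¹, Set.inv_mem_inv.2 hy.2, mul_inv_cancel_right z y⟩)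
        simp [hz, image_eq_zero_of_notMem_tsupport hz1, image_eq_zero_of_notMem_tsupport hz2]
    · simp [hk.eq_zero y hy]
  calc ‖conv ψ e - ψ‖ = ∫ z, ‖(∫ y, g (z * y) * k y ∂m) - g z‖ ∂m := by
        rw [L1.norm_eq_integral_norm]
        refine integral_congr_ae ?_
        filter_upwards [Lp.coeFn_sub (conv ψ e) ψ, hψ,
          conv_ae_eq_of_mem_mollifiers hk hek hg hgc hψ] with z h1 h2 h3
        rw [h1, Pi.sub_apply, h2, h3]
    _ ≤ ∫ z, K.indicator (fun _ => δ) z ∂m :=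
        integral_mono_of_nonneg (.of_forall fun z => norm_nonneg _)
          ((integrable_indicator_iff hKc.measurableSet).2
            (integrableOn_const (hs := hKc.measure_lt_top.ne))) (.of_forall hbound)
    _ = m.real K * δ := by
        rw [integral_indicator_const _ hKc.measurableSet, smul_eq_mul]
    _ ≤ ε := by
        rw [hδ, mul_div_assoc', div_le_iff₀ hpos]
        nlinarith

theorem exists_nhds_norm_conv_sub_le (ψ : Lp ℂ 1 m) {ε : ℝ} (hε : 0 < ε) :
    ∃ U ∈ 𝓝 (1 : G), ∀ e ∈ mollifiers m U, ‖conv ψ e - ψ‖ ≤ ε := by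
  obtain ⟨g, ψ', hg, hgc, hψ', hle⟩ := exists_hasCompactSupport_norm_sub_le ψ (ε := ε / 3) (by positivity)
  obtain ⟨U, hU, h⟩ := exists_nhds_norm_conv_sub_le_of_hasCompactSupport hg hgc hψ' (ε := ε / 3)
    (by positivity)
  refine ⟨U, hU, fun e he => ?_⟩
  have h1 : conv ψ e - ψ = conv (ψ - ψ') e + (conv ψ' e - ψ') - (ψ - ψ') := by
    have := add_conv (ψ - ψ') ψ' e
    rw [sub_add_cancel] at this
    rw [this]
    abel
  have h2 : ‖conv (ψ - ψ') e‖ ≤ ε / 3 := (norm_conv_le _ _).trans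
    ((mul_le_of_le_one_right (norm_nonneg _) (norm_le_one_of_mem_mollifiers he)).trans hle)
  rw [h1]
  calc _ ≤ ‖conv (ψ - ψ') e‖ + ‖conv ψ' e - ψ'‖ + ‖ψ - ψ'‖ := norm_sub_le_of_le (norm_add_le _ _) le_rfl
    _ ≤ ε / 3 + ε / 3 + ε / 3 := by gcongr; exact h e he
    _ = ε := by ring

/-- `L¹(G)` has a two-sided approximate identity in its unit ball. -/
theorem exists_approximateIdentity (m : Measure G) [m.IsHaarMeasure] [m.Regular] :
    ∃ l : Filter (Lp ℂ 1 m), l.NeBot ∧ (∀ᶠ e in l, ‖e‖ ≤ 1) ∧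
      (∀ ψ, Tendsto (fun e => conv e ψ) l (𝓝 ψ)) ∧ ∀ ψ, Tendsto (fun e => conv ψ e) l (𝓝 ψ) := by
  -- The filter is generated by the sets `mollifiers m U` as U shrinks to 1.
  refine ⟨(𝓝 1).lift' (mollifiers m),
    (lift'_neBot_iff (mollifiers_mono m)).2 fun U hU => mollifiers_nonempty m hU,
    mem_of_superset (mem_lift' univ_mem) fun e he => norm_le_one_of_mem_mollifiers he,
    fun ψ => Metric.tendsto_nhds.2 fun ε hε => ?_, fun ψ => Metric.tendsto_nhds.2 fun ε hε => ?_⟩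
  · have hc : ContinuousAt (fun y => ‖leftTranslate y ψ - ψ‖) 1 :=
      ((continuous_leftTranslate ψ).sub continuous_const).norm.continuousAt
    have h1 : leftTranslate 1 ψ = ψ := by
      rw [leftTranslate, inv_one]; exact one_smul _ ψ
    have hev := hc.eventually_lt (continuousAt_const (y := ε / 2)) (by simpa [h1] using hε)
    filter_upwards [mem_lift' hev] with e he
    rw [dist_eq_norm]
    exact (norm_conv_sub_le_of_mem_mollifiers he fun y hy => le_of_lt hy).trans_lt (half_lt_self hε)
  · obtain ⟨U, hU, h⟩ := exists_nhds_norm_conv_sub_le ψ (half_pos hε)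
    filter_upwards [mem_lift' hU] with e he
    rw [dist_eq_norm]
    exact (h e he).trans_lt (half_lt_self hε)

end ApproximateIdentity

end GroupAlgebra

namespace GroupAlgebra

/-! ### Vague limits of positive measures -/

section VagueCompactness

open Filter Topology CompactlySupported

theorem exists_tendsto_of_norm_le {ι E : Type*} [SeminormedAddCommGroup E] [ProperSpace E]
    (𝒰 : Ultrafilter ι) {u : ι → E} {R : ℝ} (h : ∀ i, ‖u i‖ ≤ R) : ∃ a, Tendsto u 𝒰 (𝓝 a) := by
  obtain ⟨a, -, ha⟩ := (isCompact_closedBall (0 : E) R).ultrafilter_le_nhds (𝒰.map u) (by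
    rw [le_principal_iff]
    exact Eventually.of_forall (f := (𝒰 : Filter ι)) fun i => mem_closedBall_zero_iff.2 (h i))
  exact ⟨a, ha⟩

variable {X : Type*} [TopologicalSpace X] [T2Space X] [LocallyCompactSpace X]
  [MeasurableSpace X] [BorelSpace X]

/-- A family of positive measures of bounded mass converges vaguely along any ultrafilter to a
finite regular measure. -/
theorem exists_regular_tendsto_integral {ι : Type*} (𝒰 : Ultrafilter ι) (κ : ι → Measure X)
    [∀ i, IsFiniteMeasure (κ i)] {C : ℝ} (hC : ∀ i, (κ i).real Set.univ ≤ C) :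
    ∃ ν : Measure X, IsFiniteMeasure ν ∧ ν.Regular ∧
      ∀ f : X → ℂ, Continuous f → HasCompactSupport f →
        Tendsto (fun i => ∫ x, f x ∂κ i) 𝒰 (𝓝 (∫ x, f x ∂ν)) := by
  have hint : ∀ (f : C_c(X, ℝ)) i, Integrable f (κ i) := fun f i =>
    f.continuous.integrable_of_hasCompactSupport f.hasCompactSupport
  have hbdd : ∀ (f : C_c(X, ℝ)) (c : ℝ), 0 ≤ c → (∀ x, |f x| ≤ c) →
      ∀ i, ‖∫ x, f x ∂κ i‖ ≤ c * C := fun f c hc hfc i =>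
    (norm_integral_le_of_norm_le_const (.of_forall hfc)).trans
      (mul_le_mul_of_nonneg_left (hC i) hc)
  have hex : ∀ f : C_c(X, ℝ), ∃ a, Tendsto (fun i => ∫ x, f x ∂κ i) 𝒰 (𝓝 a) := fun f => by
    obtain ⟨c, hc⟩ := f.hasCompactSupport.exists_bound_of_continuous f.continuous
    exact exists_tendsto_of_norm_le 𝒰 (hbdd f (max c 0) (le_max_right _ _)
      fun x => (hc x).trans (le_max_left _ _))
  choose Λ hΛ using hex
  -- The ultrafilter gives limits for all test functions at once; they form a positive functional,
  -- to which Riesz–Markov applies.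
  let Λ' : C_c(X, ℝ) →ₚ[ℝ] ℝ := PositiveLinearMap.mk₀
    { toFun := Λ
      map_add' := fun f g => tendsto_nhds_unique (hΛ (f + g)) <|
        ((hΛ f).add (hΛ g)).congr fun i => (integral_add (hint f i) (hint g i)).symm
      map_smul' := fun c f => tendsto_nhds_unique (hΛ (c • f)) <|
        ((hΛ f).const_mul c).congr fun i => (integral_const_mul c _).symm }
    fun f hf => ge_of_tendsto' (hΛ f) fun i => integral_nonneg hf
  have hreg : (RealRMK.rieszMeasure Λ').Regular := inferInstance
  have hΛ' : ∀ f : C_c(X, ℝ), Tendsto (fun i => ∫ x, f x ∂κ i) 𝒰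
      (𝓝 (∫ x, f x ∂(RealRMK.rieszMeasure Λ'))) := fun f => by
    rw [RealRMK.integral_rieszMeasure]
    exact hΛ f
  -- Mass may escape to infinity but cannot grow: a Urysohn function above a compact set bounds its
  -- measure by C.
  have hfin : IsFiniteMeasure (RealRMK.rieszMeasure Λ') := by
    refine ⟨lt_of_le_of_lt ?_ (ENNReal.ofReal_lt_top (r := C))⟩
    rw [isOpen_univ.measure_eq_iSup_isCompact]
    refine iSup₂_le fun K _ => iSup_le fun hK => ?_
    obtain ⟨f, f1, -, fc, f01⟩ := exists_continuous_one_zero_of_isCompact hK isClosed_empty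
      (Set.disjoint_empty K)
    refine (RealRMK.rieszMeasure_le_of_eq_one Λ' (f := ⟨f, fc⟩) (fun x => (f01 x).1) hK
      fun x hx => f1 hx).trans (ENNReal.ofReal_le_ofReal ?_)
    refine le_of_tendsto' (hΛ ⟨f, fc⟩) fun i => (le_abs_self _).trans ?_
    simpa using hbdd ⟨f, fc⟩ 1 zero_le_one
      (fun x => (abs_of_nonneg (f01 x).1).le.trans (f01 x).2) i
  refine ⟨_, hfin, hreg, fun f hf hfc => ?_⟩
  have hfi : ∀ (ν : Measure X) [IsFiniteMeasure ν], ∫ x, f x ∂ν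
      = ((∫ x, (f x).re ∂ν : ℝ) : ℂ) + (∫ x, (f x).im ∂ν : ℝ) * Complex.I := fun ν _ =>
    (integral_re_add_im (𝕜 := ℂ) (hf.integrable_of_hasCompactSupport hfc)).symm
  simp only [hfi]
  have hre := hΛ' ⟨⟨fun x => (f x).re, by fun_prop⟩, hfc.comp_left Complex.zero_re⟩
  have him := hΛ' ⟨⟨fun x => (f x).im, by fun_prop⟩, hfc.comp_left Complex.zero_im⟩
  exact ((Complex.continuous_ofReal.tendsto _).comp hre).add
    (((Complex.continuous_ofReal.tendsto _).comp him).mul_const _)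

end VagueCompactness

/-! ### Complex multiples of positive measures -/

section ComplexMeasure

variable {X : Type*} [MeasurableSpace X]

/-- The complex measure `c • κ` for a finite positive measure `κ`. -/
noncomputable def complexSMul (c : ℂ) (κ : Measure X) [IsFiniteMeasure κ] : ComplexMeasure X :=
  κ.toSignedMeasure.mapRange (LinearMap.toSpanSingleton ℝ ℂ c).toAddMonoidHom
    (ContinuousLinearMap.toSpanSingleton ℝ c).continuous

theorem complexSMul_apply (c : ℂ) (κ : Measure X) [IsFiniteMeasure κ] {s : Set X}
    (hs : MeasurableSet s) : complexSMul c κ s = κ.real s • c := by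
  change κ.toSignedMeasure s • c = _
  rw [Measure.toSignedMeasure_apply_measurable hs]

theorem variation_complexSMul_le {c : ℂ} (hc : ‖c‖ ≤ 1) (κ : Measure X) [IsFiniteMeasure κ] :
    (complexSMul c κ).variation ≤ κ := by
  refine VectorMeasure.variation_le_of_forall_enorm_le fun s hs => ?_
  rw [complexSMul_apply c κ hs, ← ofReal_norm, norm_smul, Real.norm_of_nonneg measureReal_nonneg]
  exact (ENNReal.ofReal_le_ofReal (mul_le_of_le_one_right measureReal_nonneg hc)).trans
    (ofReal_measureReal (measure_ne_top κ s)).le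

theorem integral_complexSMul {c : ℂ} (hc : ‖c‖ ≤ 1) (κ : Measure X) [IsFiniteMeasure κ]
    {f : X → ℂ} (hf : Integrable f κ) :
    (complexSMul c κ).integral f (ContinuousLinearMap.mul ℝ ℂ) = c * ∫ x, f x ∂κ := by
  have hf' : (κ.toSignedMeasure).Integrable f := by
    rwa [VectorMeasure.Integrable, Measure.variation_toSignedMeasure]
  have h1 : (complexSMul c κ).Integrable f := hf.mono_measure (variation_complexSMul_le hc κ)
  have h2 := VectorMeasure.continuousLinearMap_apply_integral
    (B := (ContinuousLinearMap.lsmul ℝ ℝ).flip) (C := ContinuousLinearMap.mul ℝ ℂ c) hf'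
  rw [VectorMeasure.integral_toSignedMeasure, ContinuousLinearMap.mul_apply'] at h2
  rw [h2, VectorMeasure.integral_eq_setToFun_transpose h1,
    VectorMeasure.integral_eq_setToFun_transpose hf']
  -- Both integrals are governed by the same operator-valued measure s ↦ (x ↦ κ(s)cx).
  have : (complexSMul c κ).transpose (ContinuousLinearMap.mul ℝ ℂ) =
      κ.toSignedMeasure.transpose
        ((ContinuousLinearMap.compL ℝ ℝ ℂ ℂ (ContinuousLinearMap.mul ℝ ℂ c)) ∘L
          (ContinuousLinearMap.lsmul ℝ ℝ).flip) := by
    ext s hs x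
    change x * (κ.toSignedMeasure s • c) = c * (κ.toSignedMeasure s • x)
    rw [Complex.real_smul, Complex.real_smul]
    ring
  congr 1
  all_goals rw [this]

end ComplexMeasure

/-! ### Weak-* limits of bounded families in L¹ -/

section WeakStarCompactness

open Filter Topology

variable {X : Type*} [TopologicalSpace X] [T2Space X] [LocallyCompactSpace X]
  [MeasurableSpace X] [BorelSpace X]

/-- A compact K ⊆ s with κ(s∖K) small also has ν(s∖K) small. This gives regularity of a variation
that is only bounded from above. -/
theorem regular_of_le {ν κ : Measure X} [IsFiniteMeasure κ] [κ.InnerRegular] (h : ν ≤ κ) :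
    ν.Regular := by
  have : IsFiniteMeasure ν := isFiniteMeasure_of_le κ h
  have : ν.InnerRegular := ⟨fun s hs r hr => by
    obtain ⟨K, hKs, hK, hlt⟩ := hs.exists_isCompact_sdiff_lt (measure_ne_top κ s)
      (tsub_pos_iff_lt.2 hr).ne'
    refine ⟨K, hKs, hK, ?_⟩
    have h1 := ((h (s \ K)).trans_lt hlt)
    have h2 : ν s = ν K + ν (s \ K) := by
      rw [measure_add_sdiff hK.nullMeasurableSet, Set.union_eq_self_of_subset_left hKs]
    by_contra! hle
    have h3 : ν s < r + (ν s - r) := by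
      conv_lhs => rw [h2]
      exact (ENNReal.add_lt_add_of_le_of_lt (measure_ne_top ν K) hle h1)
    rw [add_tsub_cancel_of_le hr.le] at h3
    exact lt_irrefl _ h3⟩
  infer_instance

theorem sum_I_pow_mul_max_re (w : ℂ) :
    ∑ k : Fin 4, Complex.I ^ (k : ℕ) * (max ((w * (-Complex.I) ^ (k : ℕ)).re) 0 : ℝ) = w := by
  have h : ∀ a : ℝ, max a 0 - max (-a) 0 = a := fun a => by
    rcases le_total a 0 with ha | ha <;> simp [ha]
  have h2 : Complex.I ^ 2 = -1 := Complex.I_sq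
  have h3 : Complex.I ^ 3 = -Complex.I := Complex.I_pow_three
  have h2' : (-Complex.I) ^ 2 = -1 := by rw [neg_sq, Complex.I_sq]
  have h3' : (-Complex.I) ^ 3 = Complex.I := by rw [Odd.neg_pow (by decide), h3, neg_neg]
  apply Complex.ext
  · simp [Fin.sum_univ_four, h2, h3, h2', h3']
    simpa [sub_eq_add_neg] using h w.re
  · simp [Fin.sum_univ_four, h2, h3, h2', h3']
    simpa [sub_eq_add_neg] using h w.im

/-- A bounded family in `L¹` converges weak-* along any ultrafilter to a regular complex measure. -/
theorem exists_complexMeasure_tendsto_integral {m : Measure X} {ι : Type*} (𝒰 : Ultrafilter ι)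
    (F : ι → Lp ℂ 1 m) {C : ℝ} (hC : ∀ i, ‖F i‖ ≤ C) :
    ∃ μ : ComplexMeasure X, μ.variation.Regular ∧
      ∀ f : X → ℂ, Continuous f → HasCompactSupport f →
        Tendsto (fun i => ∫ x, f x * F i x ∂m) 𝒰
          (𝓝 (μ.integral f (ContinuousLinearMap.mul ℝ ℂ))) := by
  -- Positive parts of F along 1, i, −1, −i: `ENNReal.ofReal` truncates at 0, and
  -- `sum_I_pow_mul_max_re` reassembles F from the four densities.
  let p : Fin 4 → ι → X → ℝ := fun k i x => (F i x * (-Complex.I) ^ (k : ℕ)).re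
  let κ : Fin 4 → ι → Measure X := fun k i => m.withDensity fun x => ENNReal.ofReal (p k i x)
  have hpm : ∀ k i, AEMeasurable (fun x => ENNReal.ofReal (p k i x)) m := fun k i =>
    ENNReal.measurable_ofReal.comp_aemeasurable (Complex.measurable_re.comp_aemeasurable
      ((L1.integrable_coeFn (F i)).1.aemeasurable.mul_const _))
  have hple : ∀ k i x, p k i x ≤ ‖F i x‖ := fun k i x => by
    refine (Complex.re_le_norm _).trans ?_
    simp
  have hmass : ∀ k i, κ k i Set.univ ≤ ENNReal.ofReal C := fun k i => by
    rw [withDensity_apply _ MeasurableSet.univ, Measure.restrict_univ]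
    refine le_trans ?_ (ENNReal.ofReal_le_ofReal (hC i))
    rw [ofReal_norm, Lp.enorm_def, eLpNorm_one_eq_lintegral_enorm]
    refine lintegral_mono fun x => ?_
    rw [← ofReal_norm]
    exact ENNReal.ofReal_le_ofReal (hple k i x)
  have hfin : ∀ k i, IsFiniteMeasure (κ k i) := fun k i =>
    ⟨(hmass k i).trans_lt ENNReal.ofReal_lt_top⟩
  have key := fun k => exists_regular_tendsto_integral 𝒰 (κ k) (C := max C 0) fun i =>
    ENNReal.toReal_le_of_le_ofReal (le_max_right _ _)
      ((hmass k i).trans (ENNReal.ofReal_le_ofReal (le_max_left _ _)))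
  choose ν hνfin hνreg hν using key
  have hI : ∀ k : Fin 4, ‖Complex.I ^ (k : ℕ)‖ ≤ 1 := fun k => by simp
  have hνi : ∀ k, (ν k).InnerRegular := fun k => inferInstance
  refine ⟨∑ k : Fin 4, complexSMul (Complex.I ^ (k : ℕ)) (ν k), ?_, fun f hf hfc => ?_⟩
  · refine regular_of_le (κ := ∑ k, ν k) ?_
    exact (VectorMeasure.variation_finsetSum_le _ _).trans
      (Finset.sum_le_sum fun k _ => variation_complexSMul_le (hI k) (ν k))
  · have hfi : ∀ (κ : Measure X) [IsFiniteMeasure κ], Integrable f κ := fun κ _ =>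
      hf.integrable_of_hasCompactSupport hfc
    rw [VectorMeasure.integral_finsetSum_vectorMeasure fun k _ =>
      (hfi (ν k)).mono_measure (variation_complexSMul_le (hI k) (ν k))]
    simp only [integral_complexSMul (hI _) _ (hfi _)]
    have hF : ∀ i, ∫ x, f x * F i x ∂m
        = ∑ k : Fin 4, Complex.I ^ (k : ℕ) * ∫ x, f x ∂κ k i := fun i => by
      have h1 : ∀ k, ∫ x, f x ∂κ k i = ∫ x, (max (p k i x) 0 : ℝ) * f x ∂m := fun k => by
        rw [integral_withDensity_eq_integral_toReal_smul₀ (hpm k i)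
          (.of_forall fun x => ENNReal.ofReal_lt_top)]
        refine integral_congr_ae (.of_forall fun x => ?_)
        simp only [ENNReal.toReal_ofReal', Complex.real_smul]
      have h2 : ∀ k, Integrable (fun x => ((max (p k i x) 0 : ℝ) : ℂ) * f x) m := fun k => by
        have := (integrable_withDensity_iff_integrable_smul₀' (hpm k i)
          (.of_forall fun x => ENNReal.ofReal_lt_top)).1 (hfi (κ k i))
        refine this.congr (.of_forall fun x => ?_)
        simp only [ENNReal.toReal_ofReal', Complex.real_smul]
      simp only [h1, ← integral_const_mul]
      rw [← integral_finsetSum _ fun k _ => (h2 k).const_mul _]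
      refine integral_congr_ae (.of_forall fun x => ?_)
      dsimp only
      conv_lhs => rw [← sum_I_pow_mul_max_re (F i x), Finset.mul_sum]
      exact Finset.sum_congr rfl fun k _ => by ring
    simp only [hF]
    exact tendsto_finsetSum _ fun k _ => (hν k f hf hfc).const_mul _

end WeakStarCompactness

end GroupAlgebra

namespace GroupAlgebra

/-! ### Weak-* continuity of convolution -/

section MeasureConvolution

open Filter Topology Pointwise

variable {G : Type*} [Group G] [TopologicalSpace G] [IsTopologicalGroup G]
  [LocallyCompactSpace G] [T2Space G] [MeasurableSpace G] [BorelSpace G]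
  {m : Measure G} [m.IsHaarMeasure] [m.Regular]

theorem measureConv_sub {μ : ComplexMeasure G} (hμ : μ ∈ measureAlgebra G) (φ ψ : Lp ℂ 1 m) :
    measureConv μ (φ - ψ) = measureConv μ φ - measureConv μ ψ := by
  rw [measureConv, measureConv, measureConv, ← VectorMeasure.integral_sub
    (integrable_measureConv hμ φ) (integrable_measureConv hμ ψ)]
  congr 1
  ext1 y
  exact map_sub (leftTranslateL m y) φ ψ

theorem norm_measureConv_le (μ : ComplexMeasure G) (φ : Lp ℂ 1 m) :
    ‖measureConv μ φ‖ ≤ ‖(ContinuousLinearMap.lsmul ℝ ℂ (E := Lp ℂ 1 m)).flip‖ *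
      μ.variation.real Set.univ * ‖φ‖ := by
  have := isFiniteMeasure_variation μ
  refine (VectorMeasure.norm_integral_le_of_norm_le_const (C := ‖φ‖)
    (.of_forall fun y => (norm_leftTranslate y φ).le)).trans (le_of_eq (by ring))

theorem continuous_integral_mul_left_apply {f : G → ℂ} (hf : Continuous f)
    (hfc : HasCompactSupport f) (ψ : Lp ℂ 1 m) : Continuous fun x => ∫ y, f (x * y) * ψ y ∂m := by
  have h := (pairing m (⟨⟨f, hf⟩, hfc.is_zero_at_infty⟩ : C₀(G, ℂ))).continuous.comp
    (continuous_leftTranslate ψ)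
  exact h.congr fun x => pairing_leftTranslate _ x ψ

/-- The weak-* limits are tested only on C_c, so transferring a convolution to the test function
requires ψ itself to have compact support; general ψ follows by density. -/
theorem hasCompactSupport_integral_mul_left_apply {f g : G → ℂ}
    (hfc : HasCompactSupport f) (hgc : HasCompactSupport g) {ψ : Lp ℂ 1 m} (hψ : ψ =ᵐ[m] g) :
    HasCompactSupport fun x => ∫ y, f (x * y) * ψ y ∂m := by
  refine HasCompactSupport.intro (K := tsupport f * (tsupport g)⁻¹)
    (IsCompact.mul hfc (IsCompact.inv hgc)) fun x hx => integral_eq_zero_of_ae ?_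
  filter_upwards [hψ] with y hy
  rw [hy]
  by_cases hyg : y ∈ tsupport g
  · have : x * y ∉ tsupport f := fun h =>
      hx ⟨x * y, h, y⁻¹, Set.inv_mem_inv.2 hyg, mul_inv_cancel_right x y⟩
    simp [image_eq_zero_of_notMem_tsupport this]
  · simp [image_eq_zero_of_notMem_tsupport hyg]

/-- Convolution on the left is weak-* continuous along bounded families. -/
theorem tendsto_integral_conv {ι : Type*} {l : Filter ι} {F : ι → Lp ℂ 1 m} {C : ℝ}
    (hC : ∀ i, ‖F i‖ ≤ C) {μ : ComplexMeasure G} (hμ : μ ∈ measureAlgebra G)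
    (hF : ∀ f : G → ℂ, Continuous f → HasCompactSupport f →
      Tendsto (fun i => ∫ x, f x * F i x ∂m) l
        (𝓝 (μ.integral f (ContinuousLinearMap.mul ℝ ℂ))))
    {f : G → ℂ} (hf : Continuous f) (hfc : HasCompactSupport f) (ψ : Lp ℂ 1 m) :
    Tendsto (fun i => ∫ x, f x * conv (F i) ψ x ∂m) l
      (𝓝 (∫ x, f x * measureConv μ ψ x ∂m)) := by
  set P := pairing m (⟨⟨f, hf⟩, hfc.is_zero_at_infty⟩ : C₀(G, ℂ)) with hP
  change Tendsto (fun i => P (conv (F i) ψ)) l (𝓝 (P (measureConv μ ψ)))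
  set D : ℝ := ‖(ContinuousLinearMap.lsmul ℝ ℂ (E := Lp ℂ 1 m)).flip‖ *
    μ.variation.real Set.univ with hD
  have hD0 : 0 ≤ D := by positivity
  refine Metric.tendsto_nhds.2 fun ε hε => ?_
  -- Bounds the error of replacing ψ by ψ′ in both convolutions; the 1 makes M positive for the
  -- division.
  set M : ℝ := ‖P‖ * (max C 0 + D) + 1 with hM
  have hM0 : 0 < M := by positivity
  obtain ⟨g, ψ', hg, hgc, hψ', hle⟩ :=
    exists_hasCompactSupport_norm_sub_le ψ (ε := ε / (2 * M)) (by positivity)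
  have hlim : Tendsto (fun i => P (conv (F i) ψ')) l (𝓝 (P (measureConv μ ψ'))) := by
    have h := hF _ (continuous_integral_mul_left_apply hf hfc ψ')
      (hasCompactSupport_integral_mul_left_apply hfc hgc hψ')
    have h1 := pairing_measureConv (⟨⟨f, hf⟩, hfc.is_zero_at_infty⟩ : C₀(G, ℂ)) hμ ψ'
    change P (measureConv μ ψ') = _ at h1
    rw [h1]
    exact h.congr fun i =>
      (pairing_conv (⟨⟨f, hf⟩, hfc.is_zero_at_infty⟩ : C₀(G, ℂ)) (F i) ψ').symm
  filter_upwards [Metric.tendsto_nhds.1 hlim (ε / 2) (half_pos hε)] with i hi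
  rw [dist_eq_norm] at hi ⊢
  have e1 : P (conv (F i) ψ) - P (measureConv μ ψ) = P (conv (F i) (ψ - ψ')) -
      P (measureConv μ (ψ - ψ')) + (P (conv (F i) ψ') - P (measureConv μ ψ')) := by
    have := conv_add (F i) (ψ - ψ') ψ'
    rw [sub_add_cancel] at this
    rw [this, measureConv_sub hμ, map_sub, map_add]
    ring
  have b1 : ‖P (conv (F i) (ψ - ψ'))‖ ≤ ‖P‖ * (max C 0 * ‖ψ - ψ'‖) :=
    (P.le_opNorm _).trans (mul_le_mul_of_nonneg_left ((norm_conv_le _ _).trans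
      (mul_le_mul_of_nonneg_right ((hC i).trans (le_max_left _ _)) (norm_nonneg _)))
      (norm_nonneg _))
  have b2 : ‖P (measureConv μ (ψ - ψ'))‖ ≤ ‖P‖ * (D * ‖ψ - ψ'‖) :=
    (P.le_opNorm _).trans (mul_le_mul_of_nonneg_left (norm_measureConv_le _ _) (norm_nonneg _))
  have b3 : ‖P‖ * (max C 0 + D) * ‖ψ - ψ'‖ ≤ ε / 2 := by
    calc _ ≤ M * (ε / (2 * M)) := mul_le_mul (by rw [hM]; linarith) hle (norm_nonneg _) hM0.le
      _ = ε / 2 := by field_simp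
  rw [e1]
  calc _ ≤ ‖P (conv (F i) (ψ - ψ'))‖ + ‖P (measureConv μ (ψ - ψ'))‖
        + ‖P (conv (F i) ψ') - P (measureConv μ ψ')‖ :=
        norm_add_le_of_le (norm_sub_le _ _) le_rfl
    _ < ‖P‖ * (max C 0 * ‖ψ - ψ'‖) + ‖P‖ * (D * ‖ψ - ψ'‖) + ε / 2 := by linarith
    _ = ‖P‖ * (max C 0 + D) * ‖ψ - ψ'‖ + ε / 2 := by ring
    _ ≤ ε := by linarith

end MeasureConvolution

/-! ### Centralizers and the approximate identity -/

section Centralizer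

open Filter Topology

variable {G : Type*} [Group G] [TopologicalSpace G] [IsTopologicalGroup G]
  [LocallyCompactSpace G] [T2Space G] [MeasurableSpace G] [BorelSpace G]
  {m : Measure G} [m.IsHaarMeasure] [m.Regular]

theorem IsJordanLeftCentralizer.map_conv_conv {α : Lp ℂ 1 m →L[ℂ] Lp ℂ 1 m}
    (hα : ∀ φ ψ, α (conv φ ψ) = conv (α φ) (α ψ)) {T : Lp ℂ 1 m → Lp ℂ 1 m}
    (hT : IsJordanLeftCentralizer α T) (φ ψ : Lp ℂ 1 m) :
    T (conv (conv φ ψ) φ) = conv (conv (T φ) (α ψ)) (α φ) := by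
  have : IsAddTorsionFree (Lp ℂ 1 m) := .of_isTorsionFree ℂ _
  let := convRing m
  exact jordanCentralizer_map_mul_mul (A := Lp ℂ 1 m) hα (_root_.map_add α) hT.map_add hT.map_sq φ ψ

/-- An additive continuous map is bounded. -/
theorem exists_norm_le_of_continuous_additive {E F : Type*} [NormedAddCommGroup E]
    [NormedSpace ℝ E] [NormedAddCommGroup F] [NormedSpace ℝ F] {T : E → F}
    (hadd : ∀ x y, T (x + y) = T x + T y) (hT : Continuous T) :
    ∃ C : ℝ, 0 ≤ C ∧ ∀ x, ‖T x‖ ≤ C * ‖x‖ := by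
  let L : E →L[ℝ] F := (AddMonoidHom.mk' T hadd).toRealLinearMap hT
  exact ⟨‖L‖, norm_nonneg _, L.le_opNorm⟩

/-- A Jordan left `α`-centralizer is the limit of left convolutions by its values on an approximate
identity. -/
theorem IsJordanLeftCentralizer.tendsto_conv {α : Lp ℂ 1 m →L[ℂ] Lp ℂ 1 m}
    (hα : ∀ φ ψ, α (conv φ ψ) = conv (α φ) (α ψ)) {T : Lp ℂ 1 m → Lp ℂ 1 m}
    (hT : IsJordanLeftCentralizer α T) (hTc : Continuous T) {l : Filter (Lp ℂ 1 m)}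
    (hl : ∀ᶠ e in l, ‖e‖ ≤ 1) (hleft : ∀ ψ, Tendsto (fun e => conv e ψ) l (𝓝 ψ))
    (hright : ∀ ψ, Tendsto (fun e => conv ψ e) l (𝓝 ψ)) (ψ : Lp ℂ 1 m) :
    Tendsto (fun e => conv (T e) (α ψ)) l (𝓝 (T ψ)) := by
  obtain ⟨C, hC0, hC⟩ := exists_norm_le_of_continuous_additive hT.map_add hTc
  have hbdd : ∀ {u : Lp ℂ 1 m → Lp ℂ 1 m} {v : Lp ℂ 1 m → Lp ℂ 1 m} {B : ℝ},
      (∀ᶠ e in l, ‖u e‖ ≤ B) → Tendsto v l (𝓝 0) →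
      Tendsto (fun e => conv (u e) (v e)) l (𝓝 0) := fun {u v B} hu hv => by
    refine squeeze_zero_norm' (a := fun e => B * ‖v e‖) ?_ (by simpa using hv.norm.const_mul B)
    filter_upwards [hu] with e he
    exact (norm_conv_le _ _).trans (mul_le_mul_of_nonneg_right he (norm_nonneg _))
  have hsub : ∀ φ ψ χ : Lp ℂ 1 m, conv φ (ψ - χ) = conv φ ψ - conv φ χ := fun φ ψ χ =>
    map_sub (convL m φ) ψ χ
  have h1 : Tendsto (fun e => conv (conv e ψ) e) l (𝓝 ψ) := by
    have := (hbdd hl (tendsto_sub_nhds_zero_iff.2 (hright ψ))).add (hleft ψ)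
    rw [zero_add] at this
    refine this.congr fun e => ?_
    rw [hsub, sub_add_cancel, conv_assoc]
  -- T(e) is bounded and the other factor tends to 0; by the Jordan identity T(e)∗α(ψ∗e) is
  -- T(e∗ψ∗e).
  have h2 : Tendsto (fun e => conv (T e) (α (conv ψ e) - α ψ)) l (𝓝 0) := by
    refine hbdd (B := C) (hl.mono fun e he => (hC e).trans (mul_le_of_le_one_right hC0 he)) ?_
    exact tendsto_sub_nhds_zero_iff.2 ((α.continuous.tendsto ψ).comp (hright ψ))
  have h3 := ((hTc.tendsto ψ).comp h1).sub h2
  rw [sub_zero] at h3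
  refine h3.congr fun e => ?_
  rw [Function.comp_apply, hT.map_conv_conv hα, hsub, hα, conv_assoc, sub_sub_cancel]

end Centralizer

end GroupAlgebra

/-! ### The representing measure -/

theorem theorem3p1 {G : Type*} [Group G] [TopologicalSpace G] [IsTopologicalGroup G]
    [LocallyCompactSpace G] [T2Space G] [MeasurableSpace G] [BorelSpace G]
    (m : Measure G) [m.IsHaarMeasure] [m.Regular]
    (α : Lp ℂ 1 m →L[ℂ] Lp ℂ 1 m)
    (hα : ∀ φ ψ, α (GroupAlgebra.conv φ ψ) = GroupAlgebra.conv (α φ) (α ψ))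
    (T : Lp ℂ 1 m → Lp ℂ 1 m) (hT : GroupAlgebra.IsJordanLeftCentralizer α T)
    (hTc : Continuous T) :
    ∃ μ ∈ GroupAlgebra.measureAlgebra G,
      ∀ φ, T φ = GroupAlgebra.measureConv μ (α φ) := by
  open GroupAlgebra Filter Topology in
  obtain ⟨l, hlne, hl, hleft, hright⟩ := exists_approximateIdentity m
  obtain ⟨C, hC0, hC⟩ := exists_norm_le_of_continuous_additive hT.map_add hTc
  have : (comap ((↑) : {e : Lp ℂ 1 m // ‖e‖ ≤ 1} → Lp ℂ 1 m) l).NeBot :=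
    comap_coe_neBot_of_le_principal (s := {e : Lp ℂ 1 m | ‖e‖ ≤ 1}) (le_principal_iff.2 hl)
  -- The index type is the unit ball, so that T(e) is bounded at every index and not merely
  -- eventually.
  let 𝒰 := Ultrafilter.of (comap ((↑) : {e : Lp ℂ 1 m // ‖e‖ ≤ 1} → Lp ℂ 1 m) l)
  have h𝒰 : Tendsto ((↑) : {e : Lp ℂ 1 m // ‖e‖ ≤ 1} → Lp ℂ 1 m) 𝒰 l :=
    tendsto_comap.mono_left (Ultrafilter.of_le _)
  have hTC : ∀ e : {e : Lp ℂ 1 m // ‖e‖ ≤ 1}, ‖T e‖ ≤ C := fun e =>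
    (hC e).trans (mul_le_of_le_one_right hC0 e.2)
  obtain ⟨μ, hμ, hlim⟩ := exists_complexMeasure_tendsto_integral 𝒰 (fun e => T e) hTC
  refine ⟨μ, hμ, fun φ => Lp_eq_of_forall_integral_mul_eq fun f hf hfc => ?_⟩
  refine tendsto_nhds_unique ?_ (tendsto_integral_conv hTC hμ hlim hf hfc (α φ))
  exact ((pairing m (⟨⟨f, hf⟩, hfc.is_zero_at_infty⟩ : C₀(G, ℂ))).continuous.tendsto _).comp
    ((hT.tendsto_conv hα hTc hl hleft hright φ).comp h𝒰)
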